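/- A \emph{derivator} is a strict 2-functor $\mathscr D\colon \mathrm{Cat}^{\mathrm{op}}\to\mathrm{CAT}$ (reversing 1-cells but not 2-cells) from small categories to large categories; write $F^*=\mathscr D(F)\colon\mathscr D(B)\to\mathscr D(A)$ for a functor $F\colon A\to B$ of small categories. It satisfies the following axioms, in which $\mathbb 1$ is the terminal category and $a\colon\mathbb 1\to A$ is the functor picking out an object $a\in A$. (1) For every small family $(A_i)$ of small categories, the canonical functor $\mathscr D(\coprod_i A_i)\to\prod_i\mathscr D(A_i)$ is an equivalence. (2) For every small category $A$, the underlying-diagram functor $\mathscr D(A)\to\mathscr D(\mathbb 1)^A$, $X\mapsto(a\mapsto a^*X)$, in which a morphism $a\to b$ of $A$ acts through the induced 2-cell $a\Rightarrow b$, is conservative. (3) Every $F^*$ has a left adjoint $F_!$ and a right adjoint $F_*$. (4) For every functor $F\colon A\to C$ of small categories and every object $c$ of $C$, with projections $p\colon(F/c)\to A$, $q\colon(F/c)\to\mathbb 1$ and $p'\colon(c/F)\to\mathbb 1$, $q'\colon(c/F)\to A$ of the comma categories, the canonical mates $q_!p^*\to c^*F_!$ and $c^*F_*\to p'_*q'^*$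 are isomorphisms. The derivator $\mathscr D$ is \emph{semi-additive} if the category $\mathscr D(\mathbb 1)$ has finite biproducts, and a semi-additive derivator is \emph{$n$-divisible} if for every object $X$ of $\mathscr D(\mathbb 1)$ the endomorphism $n\cdot\mathrm{id}_X=\mathrm{id}_X+\cdots+\mathrm{id}_X$ is invertible. \textbf{Theorem.} Let $G$ be a finite group, let $BG$ be the corresponding one-object category, and let $\mathscr D$ be a semi-additive and $|G|$-divisible derivator. Then the underlying-diagram functor \[\mathscr D(BG)\to\mathscr D(\mathbb 1)^{BG}\] is fully faithful. -/

import Mathlib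

open CategoryTheory CategoryTheory.Limits Opposite

universe w v u

/-- A prederivator: a strict 2-functor `D : Cat^op → CAT` from the 2-category of (`w`-)small
categories, with 1-cells reversed and 2-cells not reversed, to the 2-category of large categories. -/
abbrev Prederivator := StrictPseudofunctor (Cat.{w, w})ᵒᵖ Cat.{v, u}

namespace Prederivator

variable (D : Prederivator.{w, v, u})

/-- The category `D(A)` of coherent diagrams of shape `A`. -/
abbrev dia (A : Type w) [SmallCategory A] : Cat.{v, u} := D.obj (op (Cat.of A))

/-- The underlying category `D(𝟙)`, where `𝟙` is the terminal category. -/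
abbrev underlying : Cat.{v, u} := D.dia (Discrete PUnit.{w + 1})

section

variable {A B : Type w} [SmallCategory A] [SmallCategory B]

/-- The restriction functor `F^* = D(F) : D(B) → D(A)` along `F : A → B`. -/
def pull (F : A ⥤ B) : D.dia B ⥤ D.dia A := (D.map F.toCatHom.op).toFunctor

/-- The natural transformation `F^* → G^*` induced by a natural transformation `F → G`. -/
def pullMap {F G : A ⥤ B} (α : F ⟶ G) : D.pull F ⟶ D.pull G :=
  (D.map₂ (Bicategory.Opposite.op2 α.toCatHom₂)).toNatTrans

/-- The structure isomorphism (an identity, since `D` is strict) `(F ⋙ G)^* ≅ F^* ∘ G^*`. -/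
def pullComp {C : Type w} [SmallCategory C] (F : A ⥤ B) (G : B ⥤ C) :
    D.pull (F ⋙ G) ≅ D.pull G ⋙ D.pull F :=
  Cat.Hom.toNatIso (D.mapComp G.toCatHom.op F.toCatHom.op)

end

/-- The restriction `a^* : D(A) → D(𝟙)` along the functor `𝟙 → A` picking out `a`. -/
abbrev eval {A : Type w} [SmallCategory A] (a : A) : D.dia A ⥤ D.underlying :=
  D.pull (Functor.fromPUnit.{w} a)

/-- The 2-cell between functors `𝟙 → A` given by a morphism of `A`. -/
abbrev pointMap {A : Type w} [SmallCategory A] {a b : A} (f : a ⟶ b) :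
    Functor.fromPUnit.{w} a ⟶ Functor.fromPUnit.{w} b :=
  Discrete.natTrans (fun _ => f)

/-- The underlying diagram functor `D(A) → D(𝟙)^A`: it sends `X` to the diagram
`a ↦ a^* X`, whose action on morphisms of `A` comes from the action of `D` on 2-cells. -/
def underlyingDiagram (A : Type w) [SmallCategory A] : D.dia A ⥤ (A ⥤ D.underlying) where
  obj X :=
    { obj := fun a => (D.eval a).obj X
      map := fun f => (D.pullMap (pointMap f)).app X
      map_id := fun a => by
        have h : pointMap (𝟙 a) = 𝟙 (Functor.fromPUnit.{w} a) := by ext; rfl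
        rw [h]
        simp [pullMap]
        rfl
      map_comp := fun {a b c} f g => by
        have h : pointMap (f ≫ g) = pointMap f ≫ pointMap g := by ext; rfl
        rw [h]
        simp [pullMap]
        rfl }
  map φ :=
    { app := fun a => (D.eval a).map φ
      naturality := fun _ _ f => ((D.pullMap (pointMap f)).naturality φ).symm }
  map_id X := by ext a; exact (D.eval a).map_id X
  map_comp φ ψ := by ext a; exact (D.eval a).map_comp φ ψ

/-- The image under `D` of a square of small categories
```
      Q
   P₀ → B
 P |  ⇗  | V
   v     v
   A  →  C
      U
```
filled by `α : U ∘ P ⇒ V ∘ Q`, namely `P^* ∘ U^* ⇒ Q^* ∘ V^*`. -/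
def pullSquare {P₀ A B C : Type w} [SmallCategory P₀] [SmallCategory A] [SmallCategory B]
    [SmallCategory C] {P : P₀ ⥤ A} {Q : P₀ ⥤ B} {U : A ⥤ C} {V : B ⥤ C}
    (α : P ⋙ U ⟶ Q ⋙ V) : TwoSquare (D.pull U) (D.pull V) (D.pull P) (D.pull Q) :=
  TwoSquare.mk _ _ _ _ ((D.pullComp P U).inv ≫ D.pullMap α ≫ (D.pullComp Q V).hom)

/-- The axioms of a derivator, for a prederivator `D`. -/
structure IsDerivator : Prop where
  /-- `D` takes coproducts of small categories to products: the functor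
  `D(∐ᵢ Aᵢ) → ∏ᵢ D(Aᵢ)` is an equivalence. -/
  coproducts : ∀ (ι : Type w) (A : ι → Type w) [∀ i, SmallCategory (A i)],
    (Functor.pi' (fun i => D.pull (Sigma.incl (C := A) i))).IsEquivalence
  /-- The underlying diagram functors are conservative. -/
  conservative : ∀ (A : Type w) [SmallCategory A], (D.underlyingDiagram A).ReflectsIsomorphisms
  /-- Every restriction functor `F^*` has a left adjoint `F_!`. -/
  hasLeftAdjoint : ∀ {A B : Type w} [SmallCategory A] [SmallCategory B] (F : A ⥤ B),
    (D.pull F).IsRightAdjoint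
  /-- Every restriction functor `F^*` has a right adjoint `F_*`. -/
  hasRightAdjoint : ∀ {A B : Type w} [SmallCategory A] [SmallCategory B] (F : A ⥤ B),
    (D.pull F).IsLeftAdjoint
  /-- Left Kan extensions are pointwise: for `U : A → C` and an object `c : 𝟙 → C`, with
  projections `p : (U/c) → A` and `q : (U/c) → 𝟙` of the comma category, the canonical
  mate `q_! p^* → c^* U_!` is an isomorphism. -/
  leftKan : ∀ {A C : Type w} [SmallCategory A] [SmallCategory C] (U : A ⥤ C)
    (c : Discrete PUnit.{w + 1} ⥤ C)
    (Ul : D.dia A ⥤ D.dia C) (adjU : Ul ⊣ D.pull U)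
    (ql : D.dia (Comma U c) ⥤ D.underlying) (adjq : ql ⊣ D.pull (Comma.snd U c)),
    IsIso ((mateEquiv adjU adjq).symm (D.pullSquare (Comma.natTrans U c))).natTrans
  /-- Right Kan extensions are pointwise: for `V : B → C` and an object `c : 𝟙 → C`, with
  projections `p : (c/V) → 𝟙` and `q : (c/V) → B` of the comma category, the canonical
  mate `c^* V_* → p_* q^*` is an isomorphism. -/
  rightKan : ∀ {B C : Type w} [SmallCategory B] [SmallCategory C] (V : B ⥤ C)
    (c : Discrete PUnit.{w + 1} ⥤ C)
    (Vr : D.dia B ⥤ D.dia C) (adjV : D.pull V ⊣ Vr)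
    (pr : D.dia (Comma c V) ⥤ D.underlying) (adjp : D.pull (Comma.fst c V) ⊣ pr),
    IsIso (mateEquiv adjV adjp (D.pullSquare (Comma.natTrans c V))).natTrans

end Prederivator

/-- A semi-additive category is `n`-divisible if `n = 𝟙 + ⋯ + 𝟙` is invertible on every object,
for the addition of morphisms defined by the biproducts. -/
def IsDivisible (C : Type u) [Category.{v} C] [HasZeroMorphisms C] [HasFiniteBiproducts C]
    (n : ℕ) : Prop :=
  ∀ X : C,
    haveI := hasBinaryBiproducts_of_finite_biproducts C
    letI := SemiadditiveOfBinaryBiproducts.addCommMonoidHomOfHasBinaryBiproducts X X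
    IsIso (n • 𝟙 X)

/-- The one-object category `BG` of a group `G`, placed in the universe of small categories. -/
abbrev ClassifyingCategory (G : Type w) [Group G] : Type w := AsSmall.{w} (SingleObj G)

/-!
By axioms (1) and (4), `c^* e_! Z` and `c^* e_* Z` are a coproduct and a product of copies of `Z`,
indexed by the morphisms `e ⟶ c` and `c ⟶ e`. In a groupoid both index sets are the same, and if
they are finite then semi-additivity makes the norm map `e_! Z ⟶ e_* Z`, whose matrix is the
identity, invertible. The transfer `X ⟶ e_* e^* X ≅ e_! e^* X ⟶ X` acts on every value of `X` as
multiplication by the number of morphisms `e ⟶ c`, so divisibility makes it invertible and the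
counit `e_! e^* X ⟶ X` a split epimorphism. As maps out of `c^* e_! Z` are families of maps out
of `Z`, such a splitting turns every morphism of underlying diagrams into a morphism of coherent
ones, and a morphism is determined by its value at `e` since the counit is an epimorphism.
-/

section Cofan

variable {E : Type u} [Category.{v} E] {ι : Type*} {A : ι → E}

/-- The universal property of a coproduct, from its corepresenting property. -/
noncomputable def isColimitCofanOfBijective (s : Cofan A)
    (h : ∀ W : E, Function.Bijective fun (φ : s.pt ⟶ W) i => s.inj i ≫ φ) : IsColimit s :=
  Cofan.IsColimit.mk s (fun t => ((h t.pt).2 t.inj).choose)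
    (fun t => congrFun ((h t.pt).2 t.inj).choose_spec)
    (fun t _ hm => (h t.pt).1 ((funext hm).trans ((h t.pt).2 t.inj).choose_spec.symm))

/-- The universal property of a product, from its representing property. -/
noncomputable def isLimitFanOfBijective (t : Fan A)
    (h : ∀ W : E, Function.Bijective fun (φ : W ⟶ t.pt) i => φ ≫ t.proj i) : IsLimit t :=
  Fan.IsLimit.mk t (fun s => ((h s.pt).2 s.proj).choose)
    (fun s => congrFun ((h s.pt).2 s.proj).choose_spec)
    (fun s _ hm => (h s.pt).1 ((funext hm).trans ((h s.pt).2 s.proj).choose_spec.symm))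

end Cofan

section Semiadditive

variable {E : Type u} [Category.{v} E] [HasZeroMorphisms E] [HasFiniteBiproducts E]
  {ι : Type*} {X Y Z : E}

attribute [local instance] hasBinaryBiproducts_of_finite_biproducts
attribute [local instance] SemiadditiveOfBinaryBiproducts.addCommMonoidHomOfHasBinaryBiproducts

theorem semiadditive_comp_sum (s : Finset ι) (f : X ⟶ Y) (g : ι → (Y ⟶ Z)) :
    f ≫ ∑ i ∈ s, g i = ∑ i ∈ s, f ≫ g i :=
  map_sum (AddMonoidHom.mk ⟨fun g : Y ⟶ Z => f ≫ g, comp_zero⟩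
    (SemiadditiveOfBinaryBiproducts.comp_add f)) g s

theorem semiadditive_sum_comp (s : Finset ι) (f : ι → (X ⟶ Y)) (g : Y ⟶ Z) :
    (∑ i ∈ s, f i) ≫ g = ∑ i ∈ s, f i ≫ g :=
  map_sum (AddMonoidHom.mk ⟨fun f : X ⟶ Y => f ≫ g, zero_comp⟩
    (fun f k => SemiadditiveOfBinaryBiproducts.add_comp f k g)) f s

variable {A : ι → E}

theorem sum_biproduct_π_comp_ι [Fintype ι] : ∑ i, biproduct.π A i ≫ biproduct.ι A i = 𝟙 (⨁ A) := by
  classical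
  refine biproduct.hom_ext' _ _ fun j => ?_
  rw [semiadditive_comp_sum, Finset.sum_eq_single j]
  · simp
  · intro i _ hij
    simp [biproduct.ι_π_ne_assoc _ hij.symm]
  · simp

theorem biproduct_lift_comp_desc [Fintype ι] (a : ∀ i, X ⟶ A i) (b : ∀ i, A i ⟶ Y) :
    biproduct.lift a ≫ biproduct.desc b = ∑ i, a i ≫ b i := by
  rw [← Category.id_comp (biproduct.desc b), ← sum_biproduct_π_comp_ι, semiadditive_sum_comp,
    semiadditive_comp_sum]
  simp

variable {s : Cofan A} {t : Fan A} {N : s.pt ⟶ t.pt}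

theorem isIso_biproduct_desc_inj [Finite ι] (hs : IsColimit s) :
    IsIso (biproduct.desc s.inj) :=
  ((biproduct.isColimit A).coconePointUniqueUpToIso hs).isIso_hom

theorem isIso_biproduct_lift_proj [Finite ι] (ht : IsLimit t) : IsIso (biproduct.lift t.proj) :=
  (ht.conePointUniqueUpToIso (biproduct.isLimit A)).isIso_hom

theorem biproduct_desc_comp_comp_lift [Finite ι]
    (hdiag : ∀ i, s.inj i ≫ N ≫ t.proj i = 𝟙 (A i))
    (hoff : ∀ i j, i ≠ j → s.inj i ≫ N ≫ t.proj j = 0) :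
    biproduct.desc s.inj ≫ N ≫ biproduct.lift t.proj = 𝟙 (⨁ A) := by
  classical
  refine biproduct.hom_ext' _ _ fun i => biproduct.hom_ext _ _ fun j => ?_
  obtain rfl | hij := eq_or_ne i j
  · simp [hdiag]
  · simp [hoff i j hij, biproduct.ι_π_ne _ hij]

theorem isIso_of_matrix_eq_one [Finite ι] (hs : IsColimit s) (ht : IsLimit t)
    (hdiag : ∀ i, s.inj i ≫ N ≫ t.proj i = 𝟙 (A i))
    (hoff : ∀ i j, i ≠ j → s.inj i ≫ N ≫ t.proj j = 0) : IsIso N := by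
  have := isIso_biproduct_desc_inj hs
  have := isIso_biproduct_lift_proj ht
  have hN := biproduct_desc_comp_comp_lift hdiag hoff
  have : IsIso (N ≫ biproduct.lift t.proj) := by
    rw [← IsIso.inv_eq_of_hom_inv_id hN]
    infer_instance
  exact IsIso.of_isIso_comp_right N (biproduct.lift t.proj)

theorem inv_eq_sum_of_matrix_eq_one [Fintype ι] [IsIso N] (hs : IsColimit s)
    (hdiag : ∀ i, s.inj i ≫ N ≫ t.proj i = 𝟙 (A i))
    (hoff : ∀ i j, i ≠ j → s.inj i ≫ N ≫ t.proj j = 0) :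
    inv N = ∑ i, t.proj i ≫ s.inj i := by
  have := isIso_biproduct_desc_inj hs
  have hN : (N ≫ biproduct.lift t.proj) ≫ biproduct.desc s.inj = 𝟙 s.pt := by
    rw [← IsIso.inv_eq_of_hom_inv_id (biproduct_desc_comp_comp_lift hdiag hoff), IsIso.inv_hom_id]
  rw [← biproduct_lift_comp_desc]
  exact IsIso.inv_eq_of_hom_inv_id (by simpa only [Category.assoc] using hN)

end Semiadditive

namespace Prederivator

variable (D : Prederivator.{w, v, u})

section Restriction

variable {A B C : Type w} [SmallCategory A] [SmallCategory B] [SmallCategory C]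

theorem pull_comp (F : A ⥤ B) (G : B ⥤ C) : D.pull (F ⋙ G) = D.pull G ⋙ D.pull F :=
  congrArg Cat.Hom.toFunctor (D.map_comp G.toCatHom.op F.toCatHom.op)

theorem pull_id : D.pull (𝟭 A) = 𝟭 _ :=
  congrArg Cat.Hom.toFunctor (D.map_id (op (Cat.of A)))

theorem pullComp_hom_app (F : A ⥤ B) (G : B ⥤ C) (X : D.dia C) :
    (D.pullComp F G).hom.app X = eqToHom (by rw [D.pull_comp]) := by
  simp only [pullComp, D.mapComp_eq_eqToIso]
  exact Cat.eqToHom_app _ _ _ _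

theorem pullComp_inv_app (F : A ⥤ B) (G : B ⥤ C) (X : D.dia C) :
    (D.pullComp F G).inv.app X = eqToHom (by rw [D.pull_comp]) := by
  simp only [pullComp, D.mapComp_eq_eqToIso]
  exact Cat.eqToHom_app _ _ _ _

/-- The action of the prederivator on the category of functors `A ⥤ B`. -/
@[simps]
def pullFunctor (A B : Type w) [SmallCategory A] [SmallCategory B] :
    (A ⥤ B) ⥤ (D.dia B ⥤ D.dia A) where
  obj F := D.pull F
  map α := D.pullMap α
  map_id F := by
    simp only [pullMap, NatTrans.toCatHom₂_id, Bicategory.Opposite.op2_id, PrelaxFunctor.map₂_id,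
      Cat.Hom.toNatTrans_id]
    rfl
  map_comp α β := by
    simp only [pullMap, NatTrans.toCatHom₂_comp, Bicategory.Opposite.op2_comp,
      PrelaxFunctor.map₂_comp, Cat.Hom.toNatTrans_comp]
    rfl

theorem pullMap_whiskerLeft_app (F : A ⥤ B) {G H : B ⥤ C} (β : G ⟶ H) (X : D.dia C) :
    (D.pullMap (Functor.whiskerLeft F β)).app X =
      (D.pullComp F G).hom.app X ≫ (D.pull F).map ((D.pullMap β).app X) ≫
        (D.pullComp F H).inv.app X :=
  congrArg (fun θ => θ.toNatTrans.app X)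
    (D.map₂_whisker_right (Bicategory.Opposite.op2 β.toCatHom₂) F.toCatHom.op)

theorem isEquivalence_pull (F : A ⥤ B) [F.IsEquivalence] : (D.pull F).IsEquivalence :=
  (CategoryTheory.Equivalence.mk (D.pull F) (D.pull F.inv)
    (eqToIso D.pull_id.symm ≪≫ (D.pullFunctor _ _).mapIso F.asEquivalence.counitIso.symm ≪≫
      D.pullComp F.inv F)
    ((D.pullComp F F.inv).symm ≪≫ (D.pullFunctor _ _).mapIso F.asEquivalence.unitIso.symm ≪≫
      eqToIso D.pull_id)).isEquivalence_functor

end Restriction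

section Action

variable {C : Type w} [SmallCategory C] {a b c : C}

/-- The restriction `a^* ⟶ b^*` along the 2-cell given by a morphism `a ⟶ b`: this is how the
morphisms of `C` act on the values of a coherent diagram of shape `C`. -/
abbrev act (f : a ⟶ b) : D.eval a ⟶ D.eval b :=
  D.pullMap (pointMap f)

theorem act_id_app (a : C) (X : D.dia C) : (D.act (𝟙 a)).app X = 𝟙 _ :=
  ((D.underlyingDiagram C).obj X).map_id a

theorem act_comp_app (f : a ⟶ b) (g : b ⟶ c) (X : D.dia C) :
    (D.act (f ≫ g)).app X = (D.act f).app X ≫ (D.act g).app X :=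
  ((D.underlyingDiagram C).obj X).map_comp f g

end Action

section Point

variable {J : Type w} [SmallCategory J]

theorem pull_toPoint_comp_eval (r : J ⥤ Discrete PUnit.{w + 1}) (j : J) :
    D.pull r ⋙ D.eval j = 𝟭 _ := by
  rw [← D.pull_comp, Functor.punit_ext' (Functor.fromPUnit j ⋙ r) (𝟭 _), D.pull_id]

/-- The values of the constant coherent diagram `r^* Z` are `Z`. -/
def pullToPointEvalIso (r : J ⥤ Discrete PUnit.{w + 1}) (j : J) :
    D.pull r ⋙ D.eval j ≅ 𝟭 _ :=
  eqToIso (D.pull_toPoint_comp_eval r j)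

variable {D} {r s : J ⥤ Discrete PUnit.{w + 1}} {Z W : D.underlying}

/-- The value at `j` of a morphism `r^* Z ⟶ s^* W` of constant coherent diagrams. -/
def constComponent (ψ : (D.pull r).obj Z ⟶ (D.pull s).obj W) (j : J) : Z ⟶ W :=
  (D.pullToPointEvalIso r j).inv.app Z ≫ (D.eval j).map ψ ≫ (D.pullToPointEvalIso s j).hom.app W

theorem constComponent_pullSquare {C : Type w} [SmallCategory C] {x y : C}
    (α : r ⋙ Functor.fromPUnit.{w} x ⟶ s ⋙ Functor.fromPUnit.{w} y) (X : D.dia C) (j : J) :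
    constComponent ((D.pullSquare α).natTrans.app X) j = (D.act (α.app j)).app X := by
  have hα : Functor.whiskerLeft (Functor.fromPUnit.{w} j) α = pointMap (α.app j) := by ext; rfl
  have h := D.pullMap_whiskerLeft_app (Functor.fromPUnit.{w} j) α X
  rw [hα] at h
  change (D.act (α.app j)).app X = _ at h
  rw [h]
  simp [constComponent, pullToPointEvalIso, pullSquare, pullComp_hom_app, pullComp_inv_app,
    eqToHom_map, eqToHom_app]

theorem constComponent_map_comp_comp_map {Z' W' : D.underlying} (a : Z' ⟶ Z)
    (ψ : (D.pull r).obj Z ⟶ (D.pull s).obj W) (b : W ⟶ W') (j : J) :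
    constComponent ((D.pull r).map a ≫ ψ ≫ (D.pull s).map b) j = a ≫ constComponent ψ j ≫ b := by
  have ha := (D.pullToPointEvalIso r j).inv.naturality a
  have hb := (D.pullToPointEvalIso s j).hom.naturality b
  simp only [Functor.comp_map, Functor.id_map] at ha hb
  simp only [constComponent, Functor.map_comp, Category.assoc, hb, reassoc_of% ha]

end Point

end Prederivator

section Discrete

theorem isEquivalence_sigmaDesc_fromPUnit (J : Type w) [SmallCategory J] [IsDiscrete J] :
    (Sigma.desc (fun j : J => Functor.fromPUnit.{w} j)).IsEquivalence where
  faithful := ⟨by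
    rintro ⟨i, ⟨⟨⟩⟩⟩ ⟨_, ⟨⟨⟩⟩⟩ ⟨f⟩ g _
    obtain ⟨g, rfl⟩ := (Sigma.incl i).map_surjective g
    exact congrArg _ (Subsingleton.elim f g)⟩
  full := ⟨by
    rintro ⟨i, ⟨⟨⟩⟩⟩ ⟨j, ⟨⟨⟩⟩⟩ f
    obtain rfl : i = j := IsDiscrete.eq_of_hom f
    exact ⟨𝟙 _, Subsingleton.elim _ _⟩⟩
  essSurj := ⟨fun j => ⟨⟨j, ⟨⟨⟩⟩⟩, ⟨Iso.refl _⟩⟩⟩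

instance isDiscrete_comma_fromPUnit {C : Type w} [SmallCategory C] (x y : C) :
    IsDiscrete (Comma (Functor.fromPUnit.{w} x) (Functor.fromPUnit.{w} y)) where
  subsingleton _ _ := ⟨fun _ _ => CommaMorphism.ext (Subsingleton.elim _ _) (Subsingleton.elim _ _)⟩
  eq_of_hom {X Y} f := by
    obtain ⟨⟨⟨⟩⟩, ⟨⟨⟩⟩, a⟩ := X
    obtain ⟨⟨⟨⟩⟩, ⟨⟨⟩⟩, b⟩ := Y
    have h : a = b := by simpa using f.w.symm
    rw [h]

/-- The comma category of two points `x` and `y` is the discrete category on `x ⟶ y`. -/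
def homEquivComma {C : Type w} [SmallCategory C] (x y : C) :
    (x ⟶ y) ≃ Comma (Functor.fromPUnit.{w} x) (Functor.fromPUnit.{w} y) where
  toFun f := ⟨⟨⟨⟩⟩, ⟨⟨⟩⟩, f⟩
  invFun j := j.hom
  left_inv _ := rfl
  right_inv _ := rfl

end Discrete

namespace Prederivator

variable {D : Prederivator.{w, v, u}}

namespace IsDerivator

section Discrete

variable {J : Type w} [SmallCategory J] [IsDiscrete J]

theorem isEquivalence_pi'_eval (hD : D.IsDerivator) :
    (Functor.pi' fun j : J => D.eval j).IsEquivalence := by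
  let K : (Σ _ : J, Discrete PUnit.{w + 1}) ⥤ J := Sigma.desc fun j => Functor.fromPUnit.{w} j
  have : K.IsEquivalence := isEquivalence_sigmaDesc_fromPUnit J
  have := D.isEquivalence_pull K
  have := hD.coproducts J fun _ => Discrete PUnit.{w + 1}
  have hK : D.pull K ⋙ Functor.pi' (fun j => D.pull (Sigma.incl j)) =
      Functor.pi' fun j : J => D.eval j :=
    Functor.pi_ext _ _ fun j => (D.pull_comp (Sigma.incl j) K).symm
  rw [← hK]
  infer_instance

theorem bijective_constComponent (hD : D.IsDerivator) (r s : J ⥤ Discrete PUnit.{w + 1})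
    (Z W : D.underlying) :
    Function.Bijective
      (constComponent : ((D.pull r).obj Z ⟶ (D.pull s).obj W) → J → (Z ⟶ W)) := by
  have := hD.isEquivalence_pi'_eval (J := J)
  let Φ := Functor.pi' fun j : J => D.eval j
  have hΦ : Function.Bijective
      (Φ.map : ((D.pull r).obj Z ⟶ (D.pull s).obj W) → (Φ.obj _ ⟶ Φ.obj _)) :=
    ⟨Φ.map_injective, Φ.map_surjective⟩
  exact (Equiv.piCongrRight fun j => ((D.pullToPointEvalIso r j).app Z).homCongr
    ((D.pullToPointEvalIso s j).app W)).bijective.comp hΦ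

end Discrete

section KanExtension

variable {C : Type w} [SmallCategory C] {x : C}

/-- The coprojections of `y^* x_! Z`, as a coproduct of copies of `Z` indexed by `x ⟶ y`. -/
abbrev evalCofan {L : D.underlying ⥤ D.dia C} (adj : L ⊣ D.eval x) (y : C) (Z : D.underlying) :
    Cofan fun _ : x ⟶ y => Z :=
  Cofan.mk ((D.eval y).obj (L.obj Z)) fun f => adj.unit.app Z ≫ (D.act f).app (L.obj Z)

/-- The projections of `y^* x_* Z`, as a product of copies of `Z` indexed by `y ⟶ x`. -/
abbrev evalFan {R : D.underlying ⥤ D.dia C} (adj : D.eval x ⊣ R) (y : C) (Z : D.underlying) :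
    Fan fun _ : y ⟶ x => Z :=
  Fan.mk ((D.eval y).obj (R.obj Z)) fun f => (D.act f).app (R.obj Z) ≫ adj.counit.app Z

theorem bijective_evalCofan (hD : D.IsDerivator) {L : D.underlying ⥤ D.dia C}
    (adj : L ⊣ D.eval x) (y : C) (Z W : D.underlying) :
    Function.Bijective fun (φ : (D.eval y).obj (L.obj Z) ⟶ W) (f : x ⟶ y) =>
      (evalCofan adj y Z).inj f ≫ φ := by
  let p := Comma.fst (Functor.fromPUnit.{w} x) (Functor.fromPUnit.{w} y)
  let q := Comma.snd (Functor.fromPUnit.{w} x) (Functor.fromPUnit.{w} y)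
  let σ := D.pullSquare (Comma.natTrans (Functor.fromPUnit.{w} x) (Functor.fromPUnit.{w} y))
  have := hD.hasLeftAdjoint q
  let adjq := Adjunction.ofIsRightAdjoint (D.pull q)
  have := hD.leftKan (.fromPUnit x) (.fromPUnit y) L adj _ adjq
  let m : (D.pull q).leftAdjoint.obj ((D.pull p).obj Z) ⟶ (D.eval y).obj (L.obj Z) :=
    ((mateEquiv adj adjq).symm σ).natTrans.app Z
  have : IsIso m := NatIso.isIso_app_of_isIso _ _
  have hm (φ : (D.eval y).obj (L.obj Z) ⟶ W) : adjq.homEquiv _ W (m ≫ φ) =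
      (D.pull p).map (adj.unit.app Z) ≫ σ.natTrans.app (L.obj Z) ≫ (D.pull q).map φ := by
    rw [Adjunction.homEquiv_unit, Functor.map_comp, ← Category.assoc, ← Category.assoc]
    exact congrArg (· ≫ _) (unit_mateEquiv_symm adj adjq σ Z).symm
  convert ((homEquivComma x y).symm.arrowCongr (Equiv.refl (Z ⟶ W))).bijective.comp
    ((hD.bijective_constComponent p q Z W).comp
      ((adjq.homEquiv _ W).bijective.comp (asIso m).homFromEquiv.symm.bijective)) using 1
  funext φ f
  change _ = constComponent (adjq.homEquiv _ W (m ≫ φ)) (homEquivComma x y f)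
  rw [hm, constComponent_map_comp_comp_map, constComponent_pullSquare]
  exact Category.assoc _ _ _

theorem bijective_evalFan (hD : D.IsDerivator) {R : D.underlying ⥤ D.dia C}
    (adj : D.eval x ⊣ R) (y : C) (Z W : D.underlying) :
    Function.Bijective fun (φ : W ⟶ (D.eval y).obj (R.obj Z)) (f : y ⟶ x) =>
      φ ≫ (evalFan adj y Z).proj f := by
  let p := Comma.fst (Functor.fromPUnit.{w} y) (Functor.fromPUnit.{w} x)
  let q := Comma.snd (Functor.fromPUnit.{w} y) (Functor.fromPUnit.{w} x)
  let σ := D.pullSquare (Comma.natTrans (Functor.fromPUnit.{w} y) (Functor.fromPUnit.{w} x))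
  have := hD.hasRightAdjoint p
  let adjp := Adjunction.ofIsLeftAdjoint (D.pull p)
  have := hD.rightKan (.fromPUnit x) (.fromPUnit y) R adj _ adjp
  let m : (D.eval y).obj (R.obj Z) ⟶ (D.pull p).rightAdjoint.obj ((D.pull q).obj Z) :=
    (mateEquiv adj adjp σ).natTrans.app Z
  have : IsIso m := NatIso.isIso_app_of_isIso _ _
  have hm (φ : W ⟶ (D.eval y).obj (R.obj Z)) : (adjp.homEquiv W _).symm (φ ≫ m) =
      (D.pull p).map φ ≫ σ.natTrans.app (R.obj Z) ≫ (D.pull q).map (adj.counit.app Z) := by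
    rw [Adjunction.homEquiv_counit, Functor.map_comp, Category.assoc]
    exact congrArg (_ ≫ ·) (mateEquiv_counit adj adjp σ Z)
  convert ((homEquivComma y x).symm.arrowCongr (Equiv.refl (W ⟶ Z))).bijective.comp
    ((hD.bijective_constComponent p q W Z).comp
      ((adjp.homEquiv W _).symm.bijective.comp (asIso m).homToEquiv.bijective)) using 1
  funext φ f
  change _ = constComponent ((adjp.homEquiv W _).symm (φ ≫ m)) (homEquivComma y x f)
  rw [hm, constComponent_map_comp_comp_map, constComponent_pullSquare]
  rfl

/-- Axiom (4) at a point: `y^* x_! Z` is the coproduct of copies of `Z` indexed by `x ⟶ y`. -/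
noncomputable def isColimitEvalCofan (hD : D.IsDerivator) {L : D.underlying ⥤ D.dia C}
    (adj : L ⊣ D.eval x) (y : C) (Z : D.underlying) : IsColimit (evalCofan adj y Z) :=
  isColimitCofanOfBijective _ (hD.bijective_evalCofan adj y Z)

/-- Axiom (4) at a point: `y^* x_* Z` is the product of copies of `Z` indexed by `y ⟶ x`. -/
noncomputable def isLimitEvalFan (hD : D.IsDerivator) {R : D.underlying ⥤ D.dia C}
    (adj : D.eval x ⊣ R) (y : C) (Z : D.underlying) : IsLimit (evalFan adj y Z) :=
  isLimitFanOfBijective _ (hD.bijective_evalFan adj y Z)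

theorem isIso_of_isIso_eval (hD : D.IsDerivator) {X Y : D.dia C} (φ : X ⟶ Y)
    (h : ∀ c : C, IsIso ((D.eval c).map φ)) : IsIso φ := by
  have := hD.conservative C
  have : ∀ c, IsIso (((D.underlyingDiagram C).map φ).app c) := h
  have : IsIso ((D.underlyingDiagram C).map φ) := NatIso.isIso_of_isIso_app _
  exact isIso_of_reflects_iso φ (D.underlyingDiagram C)

end KanExtension

section FullFaithful

variable {C : Type w} [SmallCategory C] {e : C} {L : D.underlying ⥤ D.dia C}

theorem inj_evalCofan_comp_counit (adj : L ⊣ D.eval e) {c : C} (f : e ⟶ c) (X : D.dia C) :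
    (evalCofan adj c ((D.eval e).obj X)).inj f ≫ (D.eval c).map (adj.counit.app X) =
      (D.act f).app X := by
  have h := adj.right_triangle_components X
  have hf := (D.act f).naturality (adj.counit.app X)
  simp only [Functor.id_obj, Functor.comp_obj] at hf
  simp only [cofan_mk_inj, Category.assoc, ← hf]
  exact (reassoc_of% h) _

theorem unit_comp_proj_evalFan {R : D.underlying ⥤ D.dia C} (adj : D.eval e ⊣ R) {c : C}
    (f : c ⟶ e) (X : D.dia C) :
    (D.eval c).map (adj.unit.app X) ≫ (evalFan adj c ((D.eval e).obj X)).proj f =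
      (D.act f).app X := by
  have h := adj.left_triangle_components X
  have hf := (D.act f).naturality (adj.unit.app X)
  simp only [Functor.id_obj, Functor.comp_obj] at hf
  simp only [fan_mk_proj, reassoc_of% hf]
  exact (congrArg _ h).trans (Category.comp_id _)

theorem inj_evalCofan_comp_map (adj : L ⊣ D.eval e) {Z W : D.underlying} (a : Z ⟶ W) {c : C}
    (f : e ⟶ c) :
    (evalCofan adj c Z).inj f ≫ (D.eval c).map (L.map a) = a ≫ (evalCofan adj c W).inj f := by
  have hf := (D.act f).naturality (L.map a)
  have ha := adj.unit_naturality a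
  simp only [cofan_mk_inj, Category.assoc, ← hf]
  exact ((reassoc_of% ha) _)

theorem eval_map_comp_counit (hD : D.IsDerivator) (adj : L ⊣ D.eval e) {X Y : D.dia C} {c : C}
    (a : (D.eval e).obj X ⟶ (D.eval e).obj Y) (b : (D.eval c).obj X ⟶ (D.eval c).obj Y)
    (hab : ∀ f : e ⟶ c, (D.act f).app X ≫ b = a ≫ (D.act f).app Y) :
    (D.eval c).map (L.map a ≫ adj.counit.app Y) = (D.eval c).map (adj.counit.app X) ≫ b := by
  refine Cofan.IsColimit.hom_ext (hD.isColimitEvalCofan adj c _) _ _ fun f => ?_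
  have hL := inj_evalCofan_comp_map adj a f
  have hX := inj_evalCofan_comp_counit adj f X
  have hY := inj_evalCofan_comp_counit adj f Y
  rw [Functor.map_comp, reassoc_of% hX]
  refine ((reassoc_of% hL) _).trans ?_
  rw [hY]
  exact (hab f).symm

theorem faithful_underlyingDiagram (adj : L ⊣ D.eval e) [∀ X, Epi (adj.counit.app X)] :
    (D.underlyingDiagram C).Faithful :=
  have := adj.faithful_R_of_epi_counit_app
  .of_comp_eq (G := (evaluation C D.underlying).obj e) (H := D.eval e) rfl

theorem full_underlyingDiagram (hD : D.IsDerivator) (adj : L ⊣ D.eval e)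
    [∀ X, IsSplitEpi (adj.counit.app X)] : (D.underlyingDiagram C).Full where
  map_surjective {X Y} α := by
    let a : (D.eval e).obj X ⟶ (D.eval e).obj Y := α.app e
    refine ⟨section_ (adj.counit.app X) ≫ L.map a ≫ adj.counit.app Y, ?_⟩
    ext c
    let b : (D.eval c).obj X ⟶ (D.eval c).obj Y := α.app c
    have hab : ∀ f : e ⟶ c, (D.act f).app X ≫ b = a ≫ (D.act f).app Y := fun f => α.naturality f
    change (D.eval c).map _ = b
    rw [Functor.map_comp, hD.eval_map_comp_counit adj a b hab, ← Category.assoc,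
      ← Functor.map_comp, IsSplitEpi.id, (D.eval c).map_id]
    exact Category.id_comp b

end FullFaithful

section Norm

variable {C : Type w} [SmallCategory C] {e : C} [HasZeroMorphisms D.underlying]
  {L R : D.underlying ⥤ D.dia C}

open scoped Classical in
/-- The norm map `e_! Z ⟶ e_* Z`: its transpose `Z ⟶ e^* e_* Z` has the identity as component
at `𝟙 e` and zero as all other components. -/
noncomputable def norm (hD : D.IsDerivator) (adj : L ⊣ D.eval e) (adj' : D.eval e ⊣ R)
    (Z : D.underlying) : L.obj Z ⟶ R.obj Z :=
  (adj.homEquiv Z (R.obj Z)).symm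
    (Fan.IsLimit.lift (hD.isLimitEvalFan adj' e Z) fun f => if f = 𝟙 e then 𝟙 Z else 0)

open scoped Classical in
theorem inj_comp_eval_norm_comp_proj (hD : D.IsDerivator) (adj : L ⊣ D.eval e)
    (adj' : D.eval e ⊣ R) (Z : D.underlying) {c : C} (f : e ⟶ c) (g : c ⟶ e) :
    (evalCofan adj c Z).inj f ≫ (D.eval c).map (hD.norm adj adj' Z) ≫
      (evalFan adj' c Z).proj g = if f ≫ g = 𝟙 e then 𝟙 Z else 0 := by
  have hf := (D.act f).naturality (hD.norm adj adj' Z)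
  have hnorm : adj.unit.app Z ≫ (D.eval e).map (hD.norm adj adj' Z) =
      Fan.IsLimit.lift (hD.isLimitEvalFan adj' e Z) fun f => if f = 𝟙 e then 𝟙 Z else 0 :=
    (adj.homEquiv_unit _ _ _).symm.trans (Equiv.apply_symm_apply _ _)
  simp only [cofan_mk_inj, fan_mk_proj, Category.assoc, ← reassoc_of% hf, reassoc_of% hnorm]
  rw [← Category.assoc ((D.act f).app _), ← act_comp_app]
  exact Fan.IsLimit.fac (hD.isLimitEvalFan adj' e Z) _ (f ≫ g)

/-- The transfer endomorphism `X ⟶ e_* e^* X ≅ e_! e^* X ⟶ X`, the isomorphism being the inverse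
of the norm map. -/
noncomputable def transfer (hD : D.IsDerivator) (adj : L ⊣ D.eval e) (adj' : D.eval e ⊣ R)
    (X : D.dia C) [IsIso (hD.norm adj adj' ((D.eval e).obj X))] : X ⟶ X :=
  adj'.unit.app X ≫ inv (hD.norm adj adj' ((D.eval e).obj X)) ≫ adj.counit.app X

variable [IsGroupoid C]

/-- The projections of `c^* e_* Z`, indexed by `e ⟶ c` through inversion. -/
noncomputable abbrev evalFanInv (adj' : D.eval e ⊣ R) (c : C) (Z : D.underlying) :
    Fan fun _ : e ⟶ c => Z :=
  Fan.mk ((D.eval c).obj (R.obj Z)) fun f => (evalFan adj' c Z).proj (inv f)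

/-- `c^* e_* Z` is the product of copies of `Z` indexed by `e ⟶ c`. -/
noncomputable def isLimitEvalFanInv (hD : D.IsDerivator) (adj' : D.eval e ⊣ R) (c : C)
    (Z : D.underlying) : IsLimit (evalFanInv adj' c Z) :=
  let invEquiv : (e ⟶ c) ≃ (c ⟶ e) :=
    ⟨fun f => inv f, fun f => inv f, fun _ => IsIso.inv_inv, fun _ => IsIso.inv_inv⟩
  Fan.isLimitEquivOfEquiv invEquiv (evalFan adj' c Z) (hD.isLimitEvalFan adj' c Z)

theorem inj_comp_eval_norm_comp_proj_self (hD : D.IsDerivator) (adj : L ⊣ D.eval e)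
    (adj' : D.eval e ⊣ R) (Z : D.underlying) {c : C} (f : e ⟶ c) :
    (evalCofan adj c Z).inj f ≫ (D.eval c).map (hD.norm adj adj' Z) ≫
      (evalFanInv adj' c Z).proj f = 𝟙 Z := by
  have h := hD.inj_comp_eval_norm_comp_proj adj adj' Z f (inv f)
  rwa [if_pos (IsIso.hom_inv_id f)] at h

theorem inj_comp_eval_norm_comp_proj_ne (hD : D.IsDerivator) (adj : L ⊣ D.eval e)
    (adj' : D.eval e ⊣ R) (Z : D.underlying) {c : C} (f g : e ⟶ c) (hfg : f ≠ g) :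
    (evalCofan adj c Z).inj f ≫ (D.eval c).map (hD.norm adj adj' Z) ≫
      (evalFanInv adj' c Z).proj g = 0 := by
  have h := hD.inj_comp_eval_norm_comp_proj adj adj' Z f (inv g)
  rwa [if_neg fun hg => hfg (by simpa only [IsIso.comp_inv_eq, Category.id_comp] using hg)] at h

variable [HasFiniteBiproducts D.underlying]

theorem isIso_norm [∀ c : C, Finite (e ⟶ c)] (hD : D.IsDerivator) (adj : L ⊣ D.eval e)
    (adj' : D.eval e ⊣ R) (Z : D.underlying) : IsIso (hD.norm adj adj' Z) :=
  hD.isIso_of_isIso_eval _ fun c =>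
    isIso_of_matrix_eq_one (hD.isColimitEvalCofan adj c Z) (hD.isLimitEvalFanInv adj' c Z)
      (hD.inj_comp_eval_norm_comp_proj_self adj adj' Z)
      (hD.inj_comp_eval_norm_comp_proj_ne adj adj' Z)

attribute [local instance] hasBinaryBiproducts_of_finite_biproducts
attribute [local instance] SemiadditiveOfBinaryBiproducts.addCommMonoidHomOfHasBinaryBiproducts

theorem eval_map_transfer (hD : D.IsDerivator) (adj : L ⊣ D.eval e) (adj' : D.eval e ⊣ R)
    (X : D.dia C) [IsIso (hD.norm adj adj' ((D.eval e).obj X))] (c : C) [Finite (e ⟶ c)] :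
    (D.eval c).map (hD.transfer adj adj' X) = Nat.card (e ⟶ c) • 𝟙 ((D.eval c).obj X) := by
  have := Fintype.ofFinite (e ⟶ c)
  let Z := (D.eval e).obj X
  have hterm (f : e ⟶ c) : (D.eval c).map (adj'.unit.app X) ≫
      ((evalFanInv adj' c Z).proj f ≫ (evalCofan adj c Z).inj f) ≫
        (D.eval c).map (adj.counit.app X) = 𝟙 ((D.eval c).obj X) := by
    have hf := unit_comp_proj_evalFan adj' (inv f) X
    have hf' := inj_evalCofan_comp_counit adj f X
    rw [Category.assoc, hf']
    refine ((reassoc_of% hf) _).trans ?_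
    rw [← act_comp_app, IsIso.inv_hom_id, act_id_app]
  have hinv : (D.eval c).map (inv (hD.norm adj adj' Z)) =
      ∑ f : e ⟶ c, (evalFanInv adj' c Z).proj f ≫ (evalCofan adj c Z).inj f := by
    rw [Functor.map_inv]
    exact inv_eq_sum_of_matrix_eq_one (t := evalFanInv adj' c Z) (hD.isColimitEvalCofan adj c Z)
      (hD.inj_comp_eval_norm_comp_proj_self adj adj' Z)
      (hD.inj_comp_eval_norm_comp_proj_ne adj adj' Z)
  rw [transfer, Functor.map_comp, Functor.map_comp, hinv, semiadditive_sum_comp,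
    semiadditive_comp_sum, Finset.sum_congr rfl fun f _ => hterm f, Finset.sum_const,
    Finset.card_univ, Nat.card_eq_fintype_card]

theorem isSplitEpi_counit [∀ c : C, Finite (e ⟶ c)] (hD : D.IsDerivator) (adj : L ⊣ D.eval e)
    (hC : ∀ c : C, IsDivisible D.underlying (Nat.card (e ⟶ c))) (X : D.dia C) :
    IsSplitEpi (adj.counit.app X) := by
  have := hD.hasRightAdjoint (Functor.fromPUnit.{w} e)
  let adj' := Adjunction.ofIsLeftAdjoint (D.eval e)
  have := hD.isIso_norm adj adj' ((D.eval e).obj X)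
  have : IsIso (hD.transfer adj adj' X) := hD.isIso_of_isIso_eval _ fun c => by
    rw [eval_map_transfer]
    exact hC c _
  refine ⟨⟨inv (hD.transfer adj adj' X) ≫ adj'.unit.app X ≫ inv (hD.norm adj adj' _), ?_⟩⟩
  rw [Category.assoc, Category.assoc]
  exact IsIso.inv_hom_id (hD.transfer adj adj' X)

end Norm

end IsDerivator

end Prederivator

/-- The bijection between the automorphisms of `e` and the morphisms `e ⟶ c`, given by composition
with a chosen isomorphism `e ≅ c`. -/
noncomputable def endEquivHomOfIsPreconnected {C : Type u} [Category.{v} C] [IsGroupoid C]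
    [IsPreconnected C] (e c : C) : (e ⟶ e) ≃ (e ⟶ c) :=
  let := Groupoid.ofIsGroupoid (C := C)
  (Iso.refl e).homCongr (asIso (nonempty_hom_of_preconnected_groupoid e c).some)

theorem mainTheorem11_general (D : Prederivator.{w, v, u}) (hD : D.IsDerivator)
    [HasZeroMorphisms D.underlying] [HasFiniteBiproducts D.underlying]
    (C : Type w) [SmallCategory C] [IsGroupoid C] [IsPreconnected C] (e : C) [Finite (e ⟶ e)]
    (hC : IsDivisible D.underlying (Nat.card (e ⟶ e))) :
    (D.underlyingDiagram C).Full ∧ (D.underlyingDiagram C).Faithful := by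
  have (c : C) : Finite (e ⟶ c) := .of_equiv _ (endEquivHomOfIsPreconnected e c)
  have hcard (c : C) : Nat.card (e ⟶ e) = Nat.card (e ⟶ c) :=
    Nat.card_congr (endEquivHomOfIsPreconnected e c)
  have := hD.hasLeftAdjoint (Functor.fromPUnit.{w} e)
  let adj := Adjunction.ofIsRightAdjoint (D.eval e)
  have := hD.isSplitEpi_counit adj fun c => hcard c ▸ hC
  exact ⟨hD.full_underlyingDiagram adj, Prederivator.IsDerivator.faithful_underlyingDiagram adj⟩

section AsSmall

variable {C : Type u} [Category.{v} C]

instance isGroupoid_asSmall [IsGroupoid C] : IsGroupoid (AsSmall.{w} C) :=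
  have := (AsSmall.equiv.{v, u, w} (C := C)).isEquivalence_inverse
  isGroupoid_of_reflects_iso (AsSmall.equiv.{v, u, w} (C := C)).inverse

instance subsingleton_asSmall [Subsingleton C] : Subsingleton (AsSmall.{w} C) :=
  Equiv.ulift.subsingleton

end AsSmall

namespace ClassifyingCategory

variable (G : Type w) [Group G]

/-- The unique object of `BG`. -/
abbrev star : ClassifyingCategory G :=
  AsSmall.up.obj (SingleObj.star G)

/-- The endomorphisms of the unique object of `BG` are the elements of `G`. -/
def endStarEquiv : (star G ⟶ star G) ≃ G :=
  Equiv.ulift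

instance finite_endStar [Finite G] : Finite (star G ⟶ star G) :=
  .of_equiv G (endStarEquiv G).symm

end ClassifyingCategory

theorem mainTheorem11 (D : Prederivator.{w, v, u}) (hD : D.IsDerivator)
    [HasZeroMorphisms D.underlying] [HasFiniteBiproducts D.underlying]
    (G : Type w) [Group G] [Finite G] (hG : IsDivisible D.underlying (Nat.card G)) :
    (D.underlyingDiagram (ClassifyingCategory G)).Full ∧
      (D.underlyingDiagram (ClassifyingCategory G)).Faithful := by
  refine mainTheorem11_general D hD (ClassifyingCategory G) (.star G) ?_
  rwa [Nat.card_congr (ClassifyingCategory.endStarEquiv G)]
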